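/- Let $A$ be an associative unital ring, $B\subseteq A$ a unital subring, and let $R=C_A(B)=\{r\in A : rb=br \text{ for all } b\in B\}$ be the centralizer. Assume: (1) $A/B$ is a depth two (D2) extension: $A\otimes_B A$ is isomorphic to a direct summand of $A^n$ for some $n$ as a $B$-$A$-bimodule, and likewise (for some $n$) as an $A$-$B$-bimodule. Equivalently, with $S=\operatorname{End}({}_BA_B)$ and $T=(A\otimes_BA)^B=\{t\in A\otimes_BA : bt=tb \text{ for all } b\in B\}$, there are finitely many $t_i,u_j\in T$ and $\beta_i,\gamma_j\in S$ with $a\otimes a'=\sum_i t_i\beta_i(a)a'=\sum_j a\gamma_j(a')u_j$ for all $a,a'\in A$. (2) The natural right module $A_B$ is a progenerator (finitely generated, projective, and a generator). (3) $A/B$ is Procesi: $A=BR$, i.e. every element of $A$ is a finite sum of products $br$ with $b\in B$, $r\in R$. Write $\mathcal T=(T,\Delta,\varepsilon)$ for the $R$-coring on $T=(A\otimes_BA)^B$ with $R$-$R$-bimodule structure $r\cdot(t^1\otimes t^2)\cdot r'=rt^1\otimes t^2r'$, comultiplication $\Delta(t)=\sum_i t_i\otimes_R(\beta_i(t^1)\otimes_B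 t^2)=\sum_j (t^1\otimes_B\gamma_j(t^2))\otimes_R u_j$ (independent of the choices), and counit $\varepsilon(t)=t^1t^2$. Then $A/B$ is a Frobenius extension if and only if $\mathcal T$ is a Frobenius $R$-coring. Here $A/B$ is Frobenius if there are a $B$-$B$-bimodule homomorphism $E:A\to B$ and $e=\sum e^1\otimes e^2\in A\otimes_BA$ with $ae=ea$ and $\sum e^1E(e^2a)=a=\sum E(ae^1)e^2$ for all $a\in A$; and an $R$-coring $(\mathcal C,\Delta,\varepsilon)$ is Frobenius if there are an $R$-$R$-bimodule homomorphism $\gamma:\mathcal C\otimes_R\mathcal C\to R$ and $e\in\mathcal C$ with $re=er$ for all $r\in R$ such that $\gamma(c\otimes e)=\varepsilon(c)=\gamma(e\otimes c)$ and $\gamma(c\otimes c'_{(1)})c'_{(2)}=c_{(1)}\gamma(c_{(2)}\otimes c')$ for all $c,c'\in\mathcal C$. -/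

import Mathlib

open scoped TensorProduct
open MulOpposite

namespace DepthTwo

/-! ## Bimodules

A right `S`-module is a module over `Sᵐᵒᵖ`; the right action `m · s` is `op s • m`.  An
`R`-`S`-bimodule is an additive group with commuting actions of `R` and `Sᵐᵒᵖ`. -/

/-- Homomorphisms of `R`-`S`-bimodules. -/
structure BimoduleHom (R S M N : Type*) [AddCommGroup M] [AddCommGroup N]
    [SMul R M] [SMul Sᵐᵒᵖ M] [SMul R N] [SMul Sᵐᵒᵖ N] extends M →+ N where
  map_left : ∀ (r : R) (m : M), toFun (r • m) = r • toFun m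
  map_right : ∀ (s : S) (m : M), toFun (op s • m) = op s • toFun m

namespace BimoduleHom

instance (R S M N : Type*) [AddCommGroup M] [AddCommGroup N]
    [SMul R M] [SMul Sᵐᵒᵖ M] [SMul R N] [SMul Sᵐᵒᵖ N] :
    CoeFun (BimoduleHom R S M N) (fun _ => M → N) := ⟨fun f => f.toAddMonoidHom⟩

variable {R S M N : Type*} [Ring R] [Ring S] [AddCommGroup M] [AddCommGroup N]
  [Module R M] [Module Sᵐᵒᵖ M] [Module R N] [Module Sᵐᵒᵖ N]

/-- The underlying homomorphism of left modules. -/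
def leftLinear (f : BimoduleHom R S M N) : M →ₗ[R] N :=
  { f.toAddMonoidHom with map_smul' := f.map_left }

/-- The underlying homomorphism of right modules. -/
def rightLinear (f : BimoduleHom R S M N) : M →ₗ[Sᵐᵒᵖ] N :=
  { f.toAddMonoidHom with map_smul' := fun s m => f.map_right s.unop m }

@[simp] theorem leftLinear_apply (f : BimoduleHom R S M N) (m : M) : f.leftLinear m = f m := rfl
@[simp] theorem rightLinear_apply (f : BimoduleHom R S M N) (m : M) : f.rightLinear m = f m := rfl

theorem map_smul (f : BimoduleHom R S M N) (r : R) (m : M) : f (r • m) = r • f m :=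
  f.map_left r m
theorem map_op_smul (f : BimoduleHom R S M N) (s : S) (m : M) : f (op s • m) = op s • f m :=
  f.map_right s m
theorem map_add (f : BimoduleHom R S M N) (m m' : M) : f (m + m') = f m + f m' :=
  f.toAddMonoidHom.map_add m m'
theorem map_zero (f : BimoduleHom R S M N) : f 0 = 0 := f.toAddMonoidHom.map_zero

end BimoduleHom

/-! ## Tensor products over a noncommutative ring -/

/-- The tensor product `M ⊗_R N` of a right `R`-module `M` and a left `R`-module `N`: the quotient
of `M ⊗_ℤ N` by the relations `m r ⊗ n = m ⊗ r n`. -/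
def BalTensor (R M N : Type*) [Ring R] [AddCommGroup M] [AddCommGroup N]
    [Module Rᵐᵒᵖ M] [Module R N] : Type _ :=
  (M ⊗[ℤ] N) ⧸ AddSubgroup.closure
    {x : M ⊗[ℤ] N | ∃ (m : M) (r : R) (n : N), x = (op r • m) ⊗ₜ[ℤ] n - m ⊗ₜ[ℤ] (r • n)}

namespace BalTensor

section Basic

variable {R M N P : Type*} [Ring R] [AddCommGroup M] [AddCommGroup N] [AddCommGroup P]
  [Module Rᵐᵒᵖ M] [Module R N]

instance : AddCommGroup (BalTensor R M N) := by
  unfold BalTensor; infer_instance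

/-- The pure tensor `m ⊗ n` in `M ⊗_R N`. -/
def tmul (R : Type*) {M N : Type*} [Ring R] [AddCommGroup M] [AddCommGroup N]
    [Module Rᵐᵒᵖ M] [Module R N] (m : M) (n : N) : BalTensor R M N :=
  QuotientAddGroup.mk (m ⊗ₜ[ℤ] n)

theorem add_tmul (m m' : M) (n : N) : tmul R (m + m') n = tmul R m n + tmul R m' n :=
  congrArg QuotientAddGroup.mk (TensorProduct.add_tmul m m' n)

theorem tmul_add (m : M) (n n' : N) : tmul R m (n + n') = tmul R m n + tmul R m n' :=
  congrArg QuotientAddGroup.mk (TensorProduct.tmul_add m n n')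

theorem op_smul_tmul (m : M) (r : R) (n : N) : tmul R (op r • m) n = tmul R m (r • n) := by
  refine QuotientAddGroup.eq_iff_sub_mem.mpr (AddSubgroup.subset_closure ⟨m, r, n, rfl⟩)

/-- `m ⊗ n` as a biadditive map. -/
def mk (R M N : Type*) [Ring R] [AddCommGroup M] [AddCommGroup N]
    [Module Rᵐᵒᵖ M] [Module R N] : M →+ N →+ BalTensor R M N :=
  AddMonoidHom.mk' (fun m => AddMonoidHom.mk' (fun n => tmul R m n) (tmul_add m))
    (fun m m' => AddMonoidHom.ext (fun n => add_tmul m m' n))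

@[simp] theorem mk_apply (m : M) (n : N) : mk R M N m n = tmul R m n := rfl

@[simp] theorem zero_tmul (n : N) : tmul R (0 : M) n = 0 := by
  rw [← mk_apply, _root_.map_zero]; rfl
@[simp] theorem tmul_zero (m : M) : tmul R m (0 : N) = 0 := by
  rw [← mk_apply, _root_.map_zero]

theorem sum_tmul {ι : Type*} (s : Finset ι) (m : ι → M) (n : N) :
    tmul R (∑ i ∈ s, m i) n = ∑ i ∈ s, tmul R (m i) n :=
  map_sum ((mk R M N).flip n) m s
theorem tmul_sum {ι : Type*} (s : Finset ι) (m : M) (n : ι → N) :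
    tmul R m (∑ i ∈ s, n i) = ∑ i ∈ s, tmul R m (n i) :=
  map_sum (mk R M N m) n s

/-- The additive map out of `M ⊗_R N` induced by an `R`-balanced biadditive map. -/
def lift (f : M →+ N →+ P) (hf : ∀ m (r : R) n, f (op r • m) n = f m (r • n)) :
    BalTensor R M N →+ P :=
  QuotientAddGroup.lift _
    (TensorProduct.liftAddHom f (fun z m n => by simp)) (by
      rw [AddSubgroup.closure_le]
      rintro _ ⟨m, r, n, rfl⟩
      simp [hf])

@[simp] theorem lift_tmul (f : M →+ N →+ P) (hf : ∀ m (r : R) n, f (op r • m) n = f m (r • n))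
    (m : M) (n : N) : lift f hf (tmul R m n) = f m n := rfl

@[elab_as_elim]
theorem induction_on {p : BalTensor R M N → Prop} (x : BalTensor R M N)
    (h0 : p 0) (ht : ∀ m n, p (tmul R m n)) (ha : ∀ x y, p x → p y → p (x + y)) : p x := by
  obtain ⟨x, rfl⟩ := QuotientAddGroup.mk_surjective x
  induction x using TensorProduct.induction_on with
  | zero => exact h0
  | tmul m n => exact ht m n
  | add x y hx hy => exact ha _ _ hx hy

theorem hom_ext {f g : BalTensor R M N →+ P} (h : ∀ m n, f (tmul R m n) = g (tmul R m n)) :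
    f = g := by
  ext x
  refine induction_on x (by simp) h (fun x y hx hy => by simp [hx, hy])

/-- The map `f ⊗ g : M ⊗_R N → M' ⊗_R N'`. -/
def map {M' N' : Type*} [AddCommGroup M'] [AddCommGroup N'] [Module Rᵐᵒᵖ M'] [Module R N']
    (f : M →ₗ[Rᵐᵒᵖ] M') (g : N →ₗ[R] N') : BalTensor R M N →+ BalTensor R M' N' :=
  lift (((mk R M' N').compl₂ g.toAddMonoidHom).comp f.toAddMonoidHom)
    (fun m r n => by
      change tmul R (f (op r • m)) (g n) = tmul R (f m) (g (r • n))
      rw [map_smul, map_smul, op_smul_tmul])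

@[simp] theorem map_tmul {M' N' : Type*} [AddCommGroup M'] [AddCommGroup N'] [Module Rᵐᵒᵖ M']
    [Module R N'] (f : M →ₗ[Rᵐᵒᵖ] M') (g : N →ₗ[R] N') (m : M) (n : N) :
    map f g (tmul R m n) = tmul R (f m) (g n) := rfl

end Basic

section Actions

variable {R S M N : Type*} [Ring R] [Ring S] [AddCommGroup M] [AddCommGroup N]
  [Module Rᵐᵒᵖ M] [Module R N]

/-- If `M` is an `S`-`R`-bimodule, then `M ⊗_R N` is a left `S`-module: `s (m ⊗ n) = s m ⊗ n`. -/
instance leftModule [Module S M] [SMulCommClass S Rᵐᵒᵖ M] : Module S (BalTensor R M N) :=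
  Module.compHom (BalTensor R M N)
    { toFun := fun s => (map (R := R)
        { DistribSMul.toAddMonoidHom M s with
          map_smul' := fun r m => smul_comm s r m } LinearMap.id : AddMonoid.End (BalTensor R M N))
      map_one' := hom_ext (fun m n => congrArg (tmul R · n) (one_smul S m))
      map_mul' := fun s s' => hom_ext (fun m n => congrArg (tmul R · n) (mul_smul s s' m))
      map_zero' := hom_ext (fun m n => (congrArg (tmul R · n) (zero_smul S m)).trans (zero_tmul n))
      map_add' := fun s s' => hom_ext (fun m n =>
        (congrArg (tmul R · n) (add_smul s s' m)).trans (add_tmul _ _ _)) :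
      S →+* AddMonoid.End (BalTensor R M N) }

theorem smul_tmul [Module S M] [SMulCommClass S Rᵐᵒᵖ M] (s : S) (m : M) (n : N) :
    s • tmul R m n = tmul R (s • m) n := rfl

/-- If `N` is an `R`-`S`-bimodule, then `M ⊗_R N` is a right `S`-module: `(m ⊗ n) s = m ⊗ n s`. -/
instance rightModule [Module Sᵐᵒᵖ N] [SMulCommClass R Sᵐᵒᵖ N] :
    Module Sᵐᵒᵖ (BalTensor R M N) :=
  Module.compHom (BalTensor R M N)
    { toFun := fun s => (map (R := R) LinearMap.id
        { DistribSMul.toAddMonoidHom N s with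
          map_smul' := fun r n => (smul_comm r s n).symm } : AddMonoid.End (BalTensor R M N))
      map_one' := hom_ext (fun m n => congrArg (tmul R m) (one_smul Sᵐᵒᵖ n))
      map_mul' := fun s s' => hom_ext (fun m n => congrArg (tmul R m) (mul_smul s s' n))
      map_zero' := hom_ext (fun m n => (congrArg (tmul R m) (zero_smul Sᵐᵒᵖ n)).trans (tmul_zero m))
      map_add' := fun s s' => hom_ext (fun m n =>
        (congrArg (tmul R m) (add_smul s s' n)).trans (tmul_add _ _ _)) :
      Sᵐᵒᵖ →+* AddMonoid.End (BalTensor R M N) }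

theorem op_smul_tmul' [Module Sᵐᵒᵖ N] [SMulCommClass R Sᵐᵒᵖ N] (s : Sᵐᵒᵖ) (m : M) (n : N) :
    s • tmul R m n = tmul R m (s • n) := rfl

instance bimodule {S' : Type*} [Ring S'] [Module S M] [SMulCommClass S Rᵐᵒᵖ M]
    [Module S'ᵐᵒᵖ N] [SMulCommClass R S'ᵐᵒᵖ N] : SMulCommClass S S'ᵐᵒᵖ (BalTensor R M N) where
  smul_comm s s' x := by
    refine induction_on x (by simp) (fun m n => rfl)
      (fun x y hx hy => by simp only [smul_add, hx, hy])

end Actions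

section Assoc

variable {R S M N P : Type*} [Ring R] [Ring S] [AddCommGroup M] [AddCommGroup N] [AddCommGroup P]
  [Module Rᵐᵒᵖ M] [Module R N] [Module Sᵐᵒᵖ N] [SMulCommClass R Sᵐᵒᵖ N] [Module S P]

/-- The left `R`-module homomorphism `n ↦ n ⊗ p`. -/
def tmulRight (R : Type*) {S N P : Type*} [Ring R] [Ring S] [AddCommGroup N] [AddCommGroup P]
    [Module R N] [Module Sᵐᵒᵖ N] [SMulCommClass R Sᵐᵒᵖ N] [Module S P] (p : P) :
    N →ₗ[R] BalTensor S N P :=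
  { (mk S N P).flip p with map_smul' := fun _ _ => rfl }

/-- The associativity map `(M ⊗_R N) ⊗_S P → M ⊗_R (N ⊗_S P)`. -/
def assoc (R S M N P : Type*) [Ring R] [Ring S] [AddCommGroup M] [AddCommGroup N]
    [AddCommGroup P] [Module Rᵐᵒᵖ M] [Module R N] [Module Sᵐᵒᵖ N] [SMulCommClass R Sᵐᵒᵖ N]
    [Module S P] :
    BalTensor S (BalTensor R M N) P →+ BalTensor R M (BalTensor S N P) :=
  lift
    (AddMonoidHom.flip (AddMonoidHom.mk' (fun p : P => map (R := R) LinearMap.id (tmulRight R p))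
      (fun p p' => hom_ext (fun m n => by
        change tmul R m (tmul S n (p + p')) = tmul R m (tmul S n p) + tmul R m (tmul S n p')
        rw [tmul_add, tmul_add]))))
    (fun x s p => by
      refine induction_on x ?_ (fun m n => ?_) (fun x y hx hy => ?_)
      · simp
      · change tmul R m (tmul S (op s • n) p) = tmul R m (tmul S n (s • p))
        rw [op_smul_tmul]
      · simp only [smul_add, _root_.map_add, AddMonoidHom.add_apply, hx, hy])

@[simp] theorem assoc_tmul (m : M) (n : N) (p : P) :
    assoc R S M N P (tmul S (tmul R m n) p) = tmul R m (tmul S n p) := rfl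

end Assoc

end BalTensor

open BalTensor

/-! ## Corings -/

section ScalarContraction

variable {R C : Type*} [Ring R] [AddCommGroup C] [Module R C] [Module Rᵐᵒᵖ C]

/-- The map `ε ⊗ C : C ⊗_R C → C`, `x ⊗ y ↦ ε(x) y`. -/
def contractLeft (ε : BimoduleHom R R C R) : BalTensor R C C →+ C :=
  BalTensor.lift
    (AddMonoidHom.mk' (fun x : C => DistribSMul.toAddMonoidHom C (ε x))
      (fun x y => by ext z; simp [BimoduleHom.map_add, add_smul]))
    (fun x r y => by simp [BimoduleHom.map_op_smul, mul_smul])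

/-- The map `C ⊗ ε : C ⊗_R C → C`, `x ⊗ y ↦ x ε(y)`. -/
def contractRight (ε : BimoduleHom R R C R) : BalTensor R C C →+ C :=
  BalTensor.lift
    (AddMonoidHom.flip (AddMonoidHom.mk' (fun y : C => DistribSMul.toAddMonoidHom C (op (ε y)))
      (fun x y => by ext z; simp [BimoduleHom.map_add, add_smul])))
    (fun x r y => by simp [BimoduleHom.map_smul, mul_smul])

@[simp] theorem contractLeft_tmul (ε : BimoduleHom R R C R) (x y : C) :
    contractLeft ε (tmul R x y) = ε x • y := rfl
@[simp] theorem contractRight_tmul (ε : BimoduleHom R R C R) (x y : C) :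
    contractRight ε (tmul R x y) = op (ε y) • x := rfl

end ScalarContraction

/-- The data of an `R`-coring on an `R`-`R`-bimodule `C`: coassociative comultiplication
`Δ : C → C ⊗_R C` and counit `ε : C → R`, both homomorphisms of `R`-`R`-bimodules. -/
structure Coring (R C : Type*) [Ring R] [AddCommGroup C] [Module R C] [Module Rᵐᵒᵖ C]
    [SMulCommClass R Rᵐᵒᵖ C] where
  comul : BimoduleHom R R C (BalTensor R C C)
  counit : BimoduleHom R R C R
  coassoc : ∀ c, BalTensor.assoc R R C C C (BalTensor.map comul.rightLinear LinearMap.id (comul c))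
    = BalTensor.map LinearMap.id comul.leftLinear (comul c)
  /-- `ε(c₁) c₂ = c` -/
  counit_comul : ∀ c, contractLeft counit (comul c) = c
  /-- `c₁ ε(c₂) = c` -/
  comul_counit : ∀ c, contractRight counit (comul c) = c

namespace Coring

variable {R C : Type*} [Ring R] [AddCommGroup C] [Module R C] [Module Rᵐᵒᵖ C]
    [SMulCommClass R Rᵐᵒᵖ C]

/-- The map `C ⊗_R C → C`, `x ⊗ y ↦ γ(c ⊗ x) y`. -/
def applyLeft (γ : BimoduleHom R R (BalTensor R C C) R) (c : C) : BalTensor R C C →+ C :=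
  BalTensor.lift
    (AddMonoidHom.mk' (fun x : C => DistribSMul.toAddMonoidHom C (γ (tmul R c x)))
      (fun x y => by ext z; simp [tmul_add, BimoduleHom.map_add, add_smul]))
    (fun x r y => by
      simp [← op_smul_tmul' (op r) c x, BimoduleHom.map_op_smul, mul_smul])

/-- The map `C ⊗_R C → C`, `x ⊗ y ↦ x γ(y ⊗ c)`. -/
def applyRight (γ : BimoduleHom R R (BalTensor R C C) R) (c : C) : BalTensor R C C →+ C :=
  BalTensor.lift
    (AddMonoidHom.flip (AddMonoidHom.mk'
      (fun y : C => DistribSMul.toAddMonoidHom C (op (γ (tmul R y c))))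
      (fun x y => by ext z; simp [add_tmul, BimoduleHom.map_add, add_smul])))
    (fun x r y => by
      simp [← BalTensor.smul_tmul r y c, BimoduleHom.map_smul, mul_smul])

/-- An `R`-coring `C` is Frobenius if there are a bimodule homomorphism `γ : C ⊗_R C → R` and an
`R`-central element `e` of `C` with `γ(c ⊗ e) = ε(c) = γ(e ⊗ c)` and
`γ(c ⊗ c'₁) c'₂ = c₁ γ(c₂ ⊗ c')`. -/
def IsFrobenius (𝒞 : Coring R C) : Prop :=
  ∃ (γ : BimoduleHom R R (BalTensor R C C) R) (e : C),
    (∀ r : R, r • e = op r • e) ∧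
    (∀ c, γ (tmul R c e) = 𝒞.counit c ∧ γ (tmul R e c) = 𝒞.counit c) ∧
    ∀ c c', applyLeft γ c (𝒞.comul c') = applyRight γ c' (𝒞.comul c)

end Coring

/-! ## Ring extensions -/

section Extension

variable {A : Type*} [Ring A] (B : Subring A)

/-- The natural right `B`-module structure `A_B` on an overring `A`: `a · b = a b`. -/
instance subringRightModule : Module (↥B)ᵐᵒᵖ A := Module.compHom A (RingHom.op B.subtype)

theorem op_smul_def (b : B) (a : A) : op b • a = a * (b : A) := rfl

instance subringBimodule (C : Subring A) : SMulCommClass C (↥B)ᵐᵒᵖ A where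
  smul_comm c b a := by
    change (c : A) * (a * (b.unop : A)) = (c : A) * a * (b.unop : A)
    rw [mul_assoc]

instance overringSubringBimodule : SMulCommClass A (↥B)ᵐᵒᵖ A where
  smul_comm c b a := by
    change c * (a * (b.unop : A)) = c * a * (b.unop : A)
    rw [mul_assoc]

/-- The tensor-square `A ⊗_B A`; it is an `A`-`A`-bimodule through the outer factors. -/
abbrev TensorSquare : Type _ := BalTensor (↥B) A A

/-- `A/B` is left depth two: as a `B`-`A`-bimodule, `A ⊗_B A` is isomorphic to a direct summand
(i.e. a retract) of `Aⁿ` for some `n`. -/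
def IsLeftDepthTwo : Prop :=
  ∃ (n : ℕ) (f : BimoduleHom B A (TensorSquare B) (Fin n → A))
    (g : BimoduleHom B A (Fin n → A) (TensorSquare B)), ∀ x, g (f x) = x

/-- `A/B` is right depth two: as an `A`-`B`-bimodule, `A ⊗_B A` is isomorphic to a direct summand
(i.e. a retract) of `Aⁿ` for some `n`. -/
def IsRightDepthTwo : Prop :=
  ∃ (n : ℕ) (f : BimoduleHom A B (TensorSquare B) (Fin n → A))
    (g : BimoduleHom A B (Fin n → A) (TensorSquare B)), ∀ x, g (f x) = x

/-- `A/B` is a depth two (D2) extension. -/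
def IsDepthTwo : Prop := IsLeftDepthTwo B ∧ IsRightDepthTwo B

/-- The natural right module `A_B` is a progenerator: finitely generated, projective, and a
generator (the regular module `B_B` is a quotient of some `Aⁿ`). -/
def IsRightProgenerator : Prop :=
  Module.Finite (↥B)ᵐᵒᵖ A ∧ Module.Projective (↥B)ᵐᵒᵖ A ∧
    ∃ (n : ℕ) (f : (Fin n → A) →ₗ[(↥B)ᵐᵒᵖ] B), Function.Surjective f

/-- The centralizer `R = C_A(B)`. -/
abbrev centr : Subring A := Subring.centralizer (B : Set A)

/-- `A/B` is a Procesi extension: `A = BR`, where `R = C_A(B)`. -/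
def IsProcesi : Prop :=
  AddSubgroup.closure {x : A | ∃ b ∈ B, ∃ r ∈ centr B, x = b * r} = ⊤

variable {B} in
/-- The map `A ⊗_B A → A`, `x ⊗ y ↦ x E(y)`. -/
def applySecond (E : BimoduleHom B B A B) : TensorSquare B →+ A :=
  BalTensor.lift
    (AddMonoidHom.flip (AddMonoidHom.mk' (fun y : A => AddMonoidHom.mulRight (E y : A))
      (fun x y => by ext z; simp [BimoduleHom.map_add, mul_add])))
    (fun x r y => by simp [BimoduleHom.map_smul, op_smul_def, mul_assoc])

variable {B} in
/-- The map `A ⊗_B A → A`, `x ⊗ y ↦ E(x) y`. -/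
def applyFirst (E : BimoduleHom B B A B) : TensorSquare B →+ A :=
  BalTensor.lift
    (AddMonoidHom.mk' (fun x : A => AddMonoidHom.mulLeft (E x : A))
      (fun x y => by ext z; simp [BimoduleHom.map_add, add_mul]))
    (fun x r y => by simp [BimoduleHom.map_op_smul, Subring.smul_def, mul_assoc])

/-- `A/B` is a Frobenius extension: it has a Frobenius system, i.e. a `B`-`B`-bimodule homomorphism
`E : A → B` and a Casimir element `e = e¹ ⊗ e² ∈ (A ⊗_B A)^A` with
`e¹ E(e² a) = a = E(a e¹) e²` for all `a`. -/
def IsFrobeniusExtension : Prop :=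
  ∃ (E : BimoduleHom B B A B) (e : TensorSquare B),
    (∀ a : A, a • e = op a • e) ∧
    ∀ a : A, applySecond E (op a • e) = a ∧ applyFirst E (a • e) = a

/-! ### The `R`-bimodule `T = (A ⊗_B A)^B` -/

/-- `T = (A ⊗_B A)^B`, the `B`-central tensor-square. -/
def T : AddSubgroup (TensorSquare B) where
  carrier := {t | ∀ b : B, (b : A) • t = op (b : A) • t}
  add_mem' := fun hx hy b => by rw [smul_add, smul_add, hx b, hy b]
  zero_mem' := fun b => by simp
  neg_mem' := fun hx b => by rw [smul_neg, smul_neg, hx b]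

variable {B}

theorem centr_comm (r : centr B) (b : B) : (b : A) * (r : A) = (r : A) * (b : A) :=
  Subring.mem_centralizer_iff.mp r.2 b b.2

/-- The left action `r · t = r t¹ ⊗ t²`. -/
instance : Module (centr B) (T B) where
  smul r t := ⟨(r : A) • t.1, fun b => by
    rw [← mul_smul, centr_comm, mul_smul, t.2 b, smul_comm]⟩
  one_smul t := Subtype.ext (one_smul A t.1)
  mul_smul r s t := Subtype.ext (mul_smul (r : A) (s : A) t.1)
  smul_zero r := Subtype.ext (smul_zero (r : A))
  smul_add r s t := Subtype.ext (smul_add (r : A) s.1 t.1)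
  add_smul r s t := Subtype.ext (add_smul (r : A) (s : A) t.1)
  zero_smul t := Subtype.ext (zero_smul A t.1)

/-- The right action `t · r = t¹ ⊗ t² r`. -/
instance : Module (↥(centr B))ᵐᵒᵖ (T B) where
  smul r t := ⟨op (r.unop : A) • t.1, fun b => by
    rw [smul_comm, t.2 b, ← mul_smul, ← mul_smul, ← op_mul, ← op_mul, centr_comm]⟩
  one_smul t := Subtype.ext (one_smul Aᵐᵒᵖ t.1)
  mul_smul r s t := Subtype.ext (mul_smul (op (r.unop : A)) (op (s.unop : A)) t.1)
  smul_zero r := Subtype.ext (smul_zero (op (r.unop : A)))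
  smul_add r s t := Subtype.ext (smul_add (op (r.unop : A)) s.1 t.1)
  add_smul r s t := Subtype.ext (add_smul (op (r.unop : A)) (op (s.unop : A)) t.1)
  zero_smul t := Subtype.ext (zero_smul Aᵐᵒᵖ t.1)

theorem coe_smul_T (r : centr B) (t : T B) : ((r • t : T B) : TensorSquare B) = (r : A) • t.1 := rfl
theorem coe_op_smul_T (r : centr B) (t : T B) :
    ((op r • t : T B) : TensorSquare B) = op (r : A) • t.1 := rfl

instance : SMulCommClass (centr B) (↥(centr B))ᵐᵒᵖ (T B) where
  smul_comm r s t := Subtype.ext (smul_comm (r : A) (op (s.unop : A)) t.1)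

/-! ### The maps `β ⊗ A` and `A ⊗ γ` for `β, γ ∈ S = End_B(A)_B`, and multiplication -/

/-- The multiplication `A ⊗_B A → A`. -/
def mulMap : BimoduleHom A A (TensorSquare B) A where
  toAddMonoidHom := BalTensor.lift AddMonoidHom.mul
    (fun x b y => by simp [op_smul_def, Subring.smul_def, mul_assoc])
  map_left a x := by
    refine BalTensor.induction_on x ?_ (fun m n => ?_) (fun x y hx hy => ?_)
    · simp
    · exact mul_assoc a m n
    · simp_all [smul_add, mul_add]
  map_right a x := by
    refine BalTensor.induction_on x ?_ (fun m n => ?_) (fun x y hx hy => ?_)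
    · simp
    · exact (mul_assoc m n a).symm
    · simp_all [smul_add]

@[simp] theorem mulMap_tmul (x y : A) : mulMap (tmul B x y) = x * y := rfl

theorem mulMap_mem (t : T B) : mulMap t.1 ∈ centr B := by
  rw [Subring.mem_centralizer_iff]
  intro b hb
  have h := congrArg (fun z => mulMap z) (t.2 ⟨b, hb⟩)
  simpa only [BimoduleHom.map_smul, BimoduleHom.map_op_smul, smul_eq_mul,
    MulOpposite.smul_eq_mul_unop, unop_op] using h

/-- `β ⊗ A : A ⊗_B A → A ⊗_B A`. -/
def mapFirst (β : BimoduleHom B B A A) : TensorSquare B →+ TensorSquare B :=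
  BalTensor.map β.rightLinear LinearMap.id

/-- `A ⊗ γ : A ⊗_B A → A ⊗_B A`. -/
def mapSecond (γ : BimoduleHom B B A A) : TensorSquare B →+ TensorSquare B :=
  BalTensor.map LinearMap.id γ.leftLinear

@[simp] theorem mapFirst_tmul (β : BimoduleHom B B A A) (x y : A) :
    mapFirst β (tmul B x y) = tmul B (β x) y := rfl
@[simp] theorem mapSecond_tmul (β : BimoduleHom B B A A) (x y : A) :
    mapSecond β (tmul B x y) = tmul B x (β y) := rfl

theorem mapFirst_smul (β : BimoduleHom B B A A) (b : B) (x : TensorSquare B) :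
    mapFirst β ((b : A) • x) = (b : A) • mapFirst β x := by
  refine BalTensor.induction_on x (by simp) (fun m n => ?_)
    (fun x y hx hy => by simp only [smul_add, map_add, hx, hy])
  exact congrArg (tmul B · n) (β.map_smul b m)

theorem mapFirst_op_smul (β : BimoduleHom B B A A) (a : A) (x : TensorSquare B) :
    mapFirst β (op a • x) = op a • mapFirst β x := by
  refine BalTensor.induction_on x (by simp) (fun m n => rfl)
    (fun x y hx hy => by simp only [smul_add, map_add, hx, hy])

theorem mapSecond_smul (β : BimoduleHom B B A A) (a : A) (x : TensorSquare B) :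
    mapSecond β (a • x) = a • mapSecond β x := by
  refine BalTensor.induction_on x (by simp) (fun m n => rfl)
    (fun x y hx hy => by simp only [smul_add, map_add, hx, hy])

theorem mapSecond_op_smul (β : BimoduleHom B B A A) (b : B) (x : TensorSquare B) :
    mapSecond β (op (b : A) • x) = op (b : A) • mapSecond β x := by
  refine BalTensor.induction_on x (by simp) (fun m n => ?_)
    (fun x y hx hy => by simp only [smul_add, map_add, hx, hy])
  exact congrArg (tmul B m) (β.map_op_smul b n)

/-- `β ⊗ A` restricted to `T`: `t ↦ β(t¹) ⊗ t²`. -/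
def mapFirstT (β : BimoduleHom B B A A) : T B →+ T B :=
  ((mapFirst β).comp (T B).subtype).codRestrict (T B) (fun t b => by
    simp only [AddMonoidHom.comp_apply, AddSubgroup.coe_subtype]
    rw [← mapFirst_smul, t.2 b, mapFirst_op_smul])

/-- `A ⊗ γ` restricted to `T`: `t ↦ t¹ ⊗ γ(t²)`. -/
def mapSecondT (γ : BimoduleHom B B A A) : T B →+ T B :=
  ((mapSecond γ).comp (T B).subtype).codRestrict (T B) (fun t b => by
    simp only [AddMonoidHom.comp_apply, AddSubgroup.coe_subtype]
    rw [← mapSecond_smul, t.2 b, mapSecond_op_smul])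

theorem coe_mapFirstT (β : BimoduleHom B B A A) (t : T B) :
    (mapFirstT β t : TensorSquare B) = mapFirst β t.1 := rfl
theorem coe_mapSecondT (β : BimoduleHom B B A A) (t : T B) :
    (mapSecondT β t : TensorSquare B) = mapSecond β t.1 := rfl

/-! ### Quasibases -/

variable (B) in
/-- A left D2 quasibasis: `a ⊗ a' = ∑ tᵢ βᵢ(a) a'` with `tᵢ ∈ T` and `βᵢ ∈ End_B(A)_B`. -/
structure LeftQuasibasis where
  n : ℕ
  t : Fin n → T B
  β : Fin n → BimoduleHom B B A A
  eq : ∀ a a' : A, tmul B a a' = ∑ i, op (β i a * a') • (t i : TensorSquare B)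

variable (B) in
/-- A right D2 quasibasis: `a ⊗ a' = ∑ a γⱼ(a') uⱼ` with `uⱼ ∈ T` and `γⱼ ∈ End_B(A)_B`. -/
structure RightQuasibasis where
  n : ℕ
  u : Fin n → T B
  γ : Fin n → BimoduleHom B B A A
  eq : ∀ a a' : A, tmul B a a' = ∑ j, (a * γ j a') • (u j : TensorSquare B)

theorem IsLeftDepthTwo.exists_quasibasis (h : IsLeftDepthTwo B) : Nonempty (LeftQuasibasis B) := by
  obtain ⟨n, f, g, hgf⟩ := h
  refine ⟨⟨n, fun i => ⟨g (Pi.single i 1), fun b => ?_⟩, fun i =>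
    ⟨AddMonoidHom.mk' (fun a => f (tmul B a 1) i) (fun a a' => by
      rw [add_tmul, f.map_add]; rfl), fun b a => ?_, fun b a => ?_⟩, fun a a' => ?_⟩⟩
  · have e : b • (Pi.single i 1 : Fin n → A) = op (b : A) • (Pi.single i 1 : Fin n → A) := by
      ext j
      by_cases hj : j = i
      · subst hj; simp [Subring.smul_def]
      · simp [hj]
    calc (b : A) • g (Pi.single i 1) = g (b • Pi.single i 1) := (g.map_smul b _).symm
      _ = g (op (b : A) • Pi.single i 1) := by rw [e]
      _ = _ := g.map_op_smul (b : A) _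
  · exact congrFun (f.map_smul b (tmul B a 1)) i
  · change f (tmul B (op b • a) 1) i = op b • f (tmul B a 1) i
    rw [op_smul_tmul]
    have : tmul B a (b • (1 : A)) = op (b : A) • tmul B a 1 := by
      rw [op_smul_tmul']; simp [Subring.smul_def]
    rw [this, f.map_op_smul]; rfl
  · have h1 : f (tmul B a a') = ∑ i, op (f (tmul B a 1) i * a') • (Pi.single i 1 : Fin n → A) := by
      have : tmul B a a' = op a' • tmul B a 1 := by rw [op_smul_tmul']; simp
      rw [this, f.map_op_smul]
      ext j
      simp [Finset.sum_apply, Pi.single_apply]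
    rw [← hgf (tmul B a a'), h1]
    refine (map_sum g.toAddMonoidHom _ _).trans (Finset.sum_congr rfl (fun i _ => ?_))
    exact g.map_op_smul _ _

theorem IsRightDepthTwo.exists_quasibasis (h : IsRightDepthTwo B) :
    Nonempty (RightQuasibasis B) := by
  obtain ⟨n, f, g, hgf⟩ := h
  refine ⟨⟨n, fun i => ⟨g (Pi.single i 1), fun b => ?_⟩, fun i =>
    ⟨AddMonoidHom.mk' (fun a => f (tmul B 1 a) i) (fun a a' => by
      rw [tmul_add, f.map_add]; rfl), fun b a => ?_, fun b a => ?_⟩, fun a a' => ?_⟩⟩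
  · have e : (b : A) • (Pi.single i 1 : Fin n → A) = op b • (Pi.single i 1 : Fin n → A) := by
      ext j
      by_cases hj : j = i
      · subst hj; simp [op_smul_def]
      · simp [hj]
    calc (b : A) • g (Pi.single i 1) = g ((b : A) • Pi.single i 1) := (g.map_smul (b : A) _).symm
      _ = g (op b • Pi.single i 1) := by rw [e]
      _ = _ := g.map_op_smul b _
  · change f (tmul B 1 (b • a)) i = b • f (tmul B 1 a) i
    rw [← op_smul_tmul]
    have : tmul B (op b • (1 : A)) a = (b : A) • tmul B 1 a := by
      rw [BalTensor.smul_tmul]; simp [op_smul_def]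
    rw [this, f.map_smul]; rfl
  · exact congrFun (f.map_op_smul b (tmul B 1 a)) i
  · have h1 : f (tmul B a a') = ∑ i, (a * f (tmul B 1 a') i) • (Pi.single i 1 : Fin n → A) := by
      have : tmul B a a' = a • tmul B 1 a' := by rw [BalTensor.smul_tmul]; simp
      rw [this, f.map_smul]
      ext j
      simp [Finset.sum_apply, Pi.single_apply]
    rw [← hgf (tmul B a a'), h1]
    refine (map_sum g.toAddMonoidHom _ _).trans (Finset.sum_congr rfl (fun i _ => ?_))
    exact g.map_smul _ _

theorem LeftQuasibasis.expand (L : LeftQuasibasis B) (x : TensorSquare B) :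
    x = ∑ i, op (mulMap (mapFirst (L.β i) x)) • (L.t i : TensorSquare B) := by
  refine BalTensor.induction_on x (by simp [BimoduleHom.map_zero]) (fun m n => ?_)
    (fun x y hx hy => ?_)
  · simpa using L.eq m n
  · simp only [map_add, op_add, add_smul, Finset.sum_add_distrib]
    rw [← hx, ← hy]

theorem RightQuasibasis.expand (Q : RightQuasibasis B) (x : TensorSquare B) :
    x = ∑ j, mulMap (mapSecond (Q.γ j) x) • (Q.u j : TensorSquare B) := by
  refine BalTensor.induction_on x (by simp [BimoduleHom.map_zero]) (fun m n => ?_)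
    (fun x y hx hy => ?_)
  · simpa using Q.eq m n
  · simp only [map_add, add_smul, Finset.sum_add_distrib]
    rw [← hx, ← hy]

/-! ### The coring structure on `T` -/

/-- The counit `ε(t) = t¹ t²`. -/
def counitT : BimoduleHom (centr B) (centr B) (T B) (centr B) where
  toFun t := ⟨mulMap t.1, mulMap_mem t⟩
  map_zero' := Subtype.ext (mulMap (B := B)).map_zero
  map_add' s t := Subtype.ext (mulMap.map_add s.1 t.1)
  map_left r t := Subtype.ext (mulMap.map_smul (r : A) t.1)
  map_right r t := Subtype.ext (mulMap.map_op_smul (r : A) t.1)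

theorem coe_counitT (t : T B) : (counitT t : A) = mulMap t.1 := rfl

/-- `Δ(t) = ∑ᵢ tᵢ ⊗_R (βᵢ(t¹) ⊗_B t²)`. -/
def comulLeft (L : LeftQuasibasis B) : T B →+ BalTensor (centr B) (T B) (T B) :=
  ∑ i, ((BalTensor.mk (centr B) (T B) (T B)) (L.t i)).comp (mapFirstT (L.β i))

/-- `∑ⱼ (t¹ ⊗_B γⱼ(t²)) ⊗_R uⱼ`. -/
def comulRight (Q : RightQuasibasis B) : T B →+ BalTensor (centr B) (T B) (T B) :=
  ∑ j, ((BalTensor.mk (centr B) (T B) (T B)).flip (Q.u j)).comp (mapSecondT (Q.γ j))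

theorem comulLeft_apply (L : LeftQuasibasis B) (t : T B) :
    comulLeft L t = ∑ i, tmul (centr B) (L.t i) (mapFirstT (L.β i) t) := by
  simp [comulLeft, AddMonoidHom.finsetSum_apply]

theorem comulRight_apply (Q : RightQuasibasis B) (t : T B) :
    comulRight Q t = ∑ j, tmul (centr B) (mapSecondT (Q.γ j) t) (Q.u j) := by
  simp [comulRight, AddMonoidHom.finsetSum_apply]

theorem LeftQuasibasis.expandT (L : LeftQuasibasis B) (t : T B) :
    t = ∑ i, op (counitT (mapFirstT (L.β i) t)) • L.t i := by
  apply Subtype.ext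
  rw [AddSubgroup.val_finsetSum]
  exact L.expand t.1

theorem RightQuasibasis.expandT (Q : RightQuasibasis B) (t : T B) :
    t = ∑ j, counitT (mapSecondT (Q.γ j) t) • Q.u j := by
  apply Subtype.ext
  rw [AddSubgroup.val_finsetSum]
  exact Q.expand t.1

theorem mapFirstT_mapSecondT (β γ : BimoduleHom B B A A) (t : T B) :
    mapFirstT β (mapSecondT γ t) = mapSecondT γ (mapFirstT β t) := by
  apply Subtype.ext
  simp only [coe_mapFirstT, coe_mapSecondT]
  refine BalTensor.induction_on t.1 (by simp) (fun m n => rfl)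
    (fun x y hx hy => by simp only [map_add, hx, hy])

/-- The two formulas for the comultiplication agree; in particular it does not depend on the
choice of the quasibases. -/
theorem comulLeft_eq_comulRight (L : LeftQuasibasis B) (Q : RightQuasibasis B) (t : T B) :
    comulLeft L t = comulRight Q t := by
  rw [comulLeft_apply, comulRight_apply]
  have h1 : ∀ i, tmul (centr B) (L.t i) (mapFirstT (L.β i) t) = ∑ j, tmul (centr B)
      (op (counitT (mapFirstT (L.β i) (mapSecondT (Q.γ j) t))) • L.t i) (Q.u j) := by
    intro i
    conv_lhs => rw [Q.expandT (mapFirstT (L.β i) t), tmul_sum]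
    refine Finset.sum_congr rfl (fun j _ => ?_)
    rw [op_smul_tmul, mapFirstT_mapSecondT]
  rw [Finset.sum_congr rfl (fun i _ => h1 i), Finset.sum_comm]
  refine Finset.sum_congr rfl (fun j _ => ?_)
  rw [← sum_tmul, ← L.expandT]

theorem mapFirstT_op_smul (β : BimoduleHom B B A A) (r : centr B) (t : T B) :
    mapFirstT β (op r • t) = op r • mapFirstT β t :=
  Subtype.ext (mapFirst_op_smul β (r : A) t.1)

theorem mapSecondT_smul (β : BimoduleHom B B A A) (r : centr B) (t : T B) :
    mapSecondT β (r • t) = r • mapSecondT β t :=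
  Subtype.ext (mapSecond_smul β (r : A) t.1)

/-- The comultiplication as a homomorphism of `R`-`R`-bimodules. -/
def comulT (L : LeftQuasibasis B) (Q : RightQuasibasis B) :
    BimoduleHom (centr B) (centr B) (T B) (BalTensor (centr B) (T B) (T B)) where
  toAddMonoidHom := comulLeft L
  map_left r t := by
    change comulLeft L (r • t) = r • comulLeft L t
    simp only [comulLeft_eq_comulRight L Q, comulRight_apply, Finset.smul_sum, mapSecondT_smul]
    rfl
  map_right r t := by
    change comulLeft L (op r • t) = op r • comulLeft L t
    simp only [comulLeft_apply, Finset.smul_sum, mapFirstT_op_smul]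
    rfl

theorem comulT_apply (L : LeftQuasibasis B) (Q : RightQuasibasis B) (t : T B) :
    comulT L Q t = ∑ i, tmul (centr B) (L.t i) (mapFirstT (L.β i) t) := comulLeft_apply L t

theorem comulT_apply' (L : LeftQuasibasis B) (Q : RightQuasibasis B) (t : T B) :
    comulT L Q t = ∑ j, tmul (centr B) (mapSecondT (Q.γ j) t) (Q.u j) :=
  (comulLeft_eq_comulRight L Q t).trans (comulRight_apply Q t)

theorem coassocT (L : LeftQuasibasis B) (Q : RightQuasibasis B) (t : T B) :
    BalTensor.assoc (centr B) (centr B) (T B) (T B) (T B)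
      (BalTensor.map (comulT L Q).rightLinear LinearMap.id (comulT L Q t)) =
    BalTensor.map LinearMap.id (comulT L Q).leftLinear (comulT L Q t) := by
  have h1 : BalTensor.assoc (centr B) (centr B) (T B) (T B) (T B)
      (BalTensor.map (comulT L Q).rightLinear LinearMap.id (comulT L Q t)) =
      ∑ j, ∑ i, tmul (centr B) (L.t i)
        (tmul (centr B) (mapFirstT (L.β i) (mapSecondT (Q.γ j) t)) (Q.u j)) := by
    rw [comulT_apply' L Q t, map_sum, map_sum]
    refine Finset.sum_congr rfl (fun j _ => ?_)
    rw [map_tmul, BimoduleHom.rightLinear_apply, comulT_apply, LinearMap.id_apply, sum_tmul,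
      map_sum]
    exact Finset.sum_congr rfl (fun i _ => assoc_tmul _ _ _)
  have h2 : BalTensor.map LinearMap.id (comulT L Q).leftLinear (comulT L Q t) =
      ∑ i, ∑ j, tmul (centr B) (L.t i)
        (tmul (centr B) (mapFirstT (L.β i) (mapSecondT (Q.γ j) t)) (Q.u j)) := by
    rw [comulT_apply L Q t, map_sum]
    refine Finset.sum_congr rfl (fun i _ => ?_)
    rw [map_tmul, BimoduleHom.leftLinear_apply, comulT_apply', LinearMap.id_apply, tmul_sum]
    exact Finset.sum_congr rfl (fun j _ => by rw [mapFirstT_mapSecondT])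
  rw [h1, h2, Finset.sum_comm]

/-- The `R`-coring `(T, Δ, ε)` determined by left and right D2 quasibases. -/
def coringOfQuasibases (L : LeftQuasibasis B) (Q : RightQuasibasis B) :
    Coring (centr B) (T B) where
  comul := comulT L Q
  counit := counitT
  coassoc := coassocT L Q
  counit_comul t := by
    rw [comulT_apply' L Q t, map_sum]
    simp only [contractLeft_tmul]
    exact (Q.expandT t).symm
  comul_counit t := by
    rw [comulT_apply L Q t, map_sum]
    simp only [contractRight_tmul]
    exact (L.expandT t).symm

/-- The `R`-coring `𝒯 = (T, Δ, ε)` of a depth two extension `A/B`. -/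
noncomputable def coringT (h : IsDepthTwo B) : Coring (centr B) (T B) :=
  coringOfQuasibases h.1.exists_quasibasis.some h.2.exists_quasibasis.some

theorem coringT_counit (h : IsDepthTwo B) (t : T B) : ((coringT h).counit t : A) = mulMap t.1 := rfl

/-- The comultiplication is given by the formula for every left quasibasis. -/
theorem coringT_comul (h : IsDepthTwo B) (L : LeftQuasibasis B) (t : T B) :
    (coringT h).comul t = ∑ i, tmul (centr B) (L.t i) (mapFirstT (L.β i) t) := by
  rw [← comulLeft_apply, comulLeft_eq_comulRight L h.2.exists_quasibasis.some]
  exact comulLeft_eq_comulRight _ _ t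

/-- The comultiplication is given by the formula for every right quasibasis. -/
theorem coringT_comul' (h : IsDepthTwo B) (Q : RightQuasibasis B) (t : T B) :
    (coringT h).comul t = ∑ j, tmul (centr B) (mapSecondT (Q.γ j) t) (Q.u j) := by
  rw [← comulRight_apply]
  exact comulLeft_eq_comulRight _ Q t

end Extension

end DepthTwo

namespace DepthTwo

open BalTensor

section

variable {A : Type*} [Ring A] {B : Subring A}

/-! ### Frobenius extensions give Frobenius corings -/

/-! From a Frobenius system `E`, `e`, the coring pairing is `t ⊗ t' ↦ t¹ E(t² t'¹) t'²` and its unit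
element is `e` itself. After expansion in the quasibases, the two sides of the coring identity on
pure tensors `a ⊗ b`, `c ⊗ d` become `a E(bc) ⊗ d` and `a ⊗ E(bc) d`, which agree because `E(bc) ∈
B` (`sandwich_quasibasis`). The two counit conditions are the two Frobenius equations.

Conversely, given `γ` and `e`, put `F(a) = ∑ⱼ γⱼ(a) γ(uⱼ ⊗ 1_T)` with `1_T = 1 ⊗ 1`. The quasibasis
expansion gives `t¹ F(t²) = γ(t ⊗ 1_T)`, hence `F(r) = γ(1_T ⊗ r 1_T)` on `R`. Since `A = BR`, these
values determine `F`, so `F` is also `∑ᵢ γ(1_T ⊗ tᵢ) βᵢ`, which gives `F(t¹) t² = γ(1_T ⊗ t)`.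

It remains to see that `F` takes values in `B` (`frobeniusEnd_mem`). The coring identity at `1_T`
and `r 1_T` says exactly `F(r) ⊗ 1 = 1 ⊗ F(r)`, and the generator property of `A_B` turns this into
`F(r) ∈ B` (`mem_of_tmul_one_eq`); then `F(br) = b F(r)` covers all of `A`. The element `e` commutes
with `B` and with `R`, hence with `A`, and the counit conditions become the Frobenius equations for
`F` and `e`. -/

theorem applySecond_smul (E : BimoduleHom B B A B) (a : A) (x : TensorSquare B) :
    applySecond E (a • x) = a * applySecond E x := by
  refine BalTensor.induction_on x (by simp) (fun m n => mul_assoc a m _)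
    (fun x y hx hy => by simp only [smul_add, map_add, hx, hy, mul_add])

theorem applySecond_op_smul (E : BimoduleHom B B A B) (b : B) (x : TensorSquare B) :
    applySecond E (op (b : A) • x) = applySecond E x * b := by
  refine BalTensor.induction_on x (by simp) (fun m n => ?_)
    (fun x y hx hy => by simp only [smul_add, map_add, hx, hy, add_mul])
  change m * (E (op b • n) : A) = m * (E n : A) * b
  rw [BimoduleHom.map_op_smul, mul_assoc]
  rfl

/-- The biadditive map `(x ⊗ y, z ⊗ w) ↦ x E(y z) w`. -/
def sandwich (E : BimoduleHom B B A B) (x : TensorSquare B) : TensorSquare B →+ A :=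
  BalTensor.lift
    (AddMonoidHom.mk' (fun z : A => AddMonoidHom.mulLeft (applySecond E (op z • x)))
      (fun z z' => by ext w; simp [add_smul, add_mul]))
    (fun z b w => by
      change applySecond E (op (z * (b : A)) • x) * w = applySecond E (op z • x) * ((b : A) * w)
      rw [op_mul, mul_smul, applySecond_op_smul, mul_assoc])

@[simp] theorem sandwich_tmul (E : BimoduleHom B B A B) (x : TensorSquare B) (z w : A) :
    sandwich E x (tmul B z w) = applySecond E (op z • x) * w := rfl

theorem sandwich_tmul_tmul (E : BimoduleHom B B A B) (x y z w : A) :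
    sandwich E (tmul B x y) (tmul B z w) = x * E (y * z) * w := rfl

theorem sandwich_add (E : BimoduleHom B B A B) (x x' y : TensorSquare B) :
    sandwich E (x + x') y = sandwich E x y + sandwich E x' y := by
  refine BalTensor.induction_on y (by simp) (fun z w => ?_) (fun y y' hy hy' => ?_)
  · simp [add_mul]
  · simp only [map_add, hy, hy']
    abel

@[simp] theorem sandwich_zero (E : BimoduleHom B B A B) (y : TensorSquare B) :
    sandwich E 0 y = 0 := by
  have h := sandwich_add E 0 0 y
  rwa [add_zero, left_eq_add] at h

theorem sandwich_smul (E : BimoduleHom B B A B) (a : A) (x y : TensorSquare B) :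
    sandwich E (a • x) y = a * sandwich E x y := by
  refine BalTensor.induction_on y (by simp) (fun z w => ?_) (fun y y' hy hy' => ?_)
  · rw [sandwich_tmul, sandwich_tmul, ← smul_comm, applySecond_smul, mul_assoc]
  · simp only [map_add, hy, hy', mul_add]

theorem sandwich_op_smul (E : BimoduleHom B B A B) (a : A) (x y : TensorSquare B) :
    sandwich E x (op a • y) = sandwich E x y * a := by
  refine BalTensor.induction_on y (by simp) (fun z w => ?_) (fun y y' hy hy' => ?_)
  · exact (mul_assoc _ w a).symm
  · simp only [smul_add, map_add, hy, hy', add_mul]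

/-- Both sides insert `a` in the middle, `x E(y a z) w`. The pairing is thus balanced over all of
`A`, in particular over `R`. -/
theorem sandwich_balanced (E : BimoduleHom B B A B) (a : A) (x y : TensorSquare B) :
    sandwich E (op a • x) y = sandwich E x (a • y) := by
  refine BalTensor.induction_on y (by simp) (fun z w => ?_) (fun y y' hy hy' => ?_)
  · rw [BalTensor.smul_tmul, sandwich_tmul, sandwich_tmul, ← mul_smul, ← op_mul, smul_eq_mul]
  · simp only [smul_add, map_add, hy, hy']

/-- An element of `B` on the left passes through `t` by centrality, across the middle by
balancedness, and through `t'` by centrality again. -/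
theorem sandwich_mem_centr (E : BimoduleHom B B A B) (t t' : T B) :
    sandwich E t.1 t'.1 ∈ centr B := by
  rw [Subring.mem_centralizer_iff]
  intro b hb
  rw [← sandwich_smul, t.2 ⟨b, hb⟩, sandwich_balanced, t'.2 ⟨b, hb⟩, sandwich_op_smul]

/-- The pairing `t ⊗ t' ↦ t¹ E(t² t'¹) t'²` on `T`. -/
def pairingT (E : BimoduleHom B B A B) :
    BimoduleHom (centr B) (centr B) (BalTensor (centr B) (T B) (T B)) (centr B) where
  toAddMonoidHom := BalTensor.lift
    (AddMonoidHom.mk' (fun t => AddMonoidHom.mk'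
        (fun t' => (⟨sandwich E t.1 t'.1, sandwich_mem_centr E t t'⟩ : centr B))
        (fun s s' => Subtype.ext ((sandwich E t.1).map_add s.1 s'.1)))
      (fun s s' => by
        ext t
        exact sandwich_add E s.1 s'.1 t.1))
    (fun t r t' => Subtype.ext (sandwich_balanced E (r : A) t.1 t'.1))
  map_left r x := by
    refine BalTensor.induction_on x (by simp) (fun t t' => ?_) (fun x y hx hy => ?_)
    · exact Subtype.ext (sandwich_smul E (r : A) t.1 t'.1)
    · simp_all [smul_add, mul_add]
  map_right r x := by
    refine BalTensor.induction_on x (by simp) (fun t t' => ?_) (fun x y hx hy => ?_)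
    · exact Subtype.ext (sandwich_op_smul E (r : A) t.1 t'.1)
    · simp_all [smul_add]

theorem coe_pairingT (E : BimoduleHom B B A B) (t t' : T B) :
    (pairingT E (tmul (centr B) t t') : A) = sandwich E t.1 t'.1 := rfl

/-- This is the Frobenius identity of the coring, stated for arbitrary tensors so that it can be
checked on pure ones. There the quasibases collapse the sums to `a E(bc) ⊗ d` and `a ⊗ E(bc) d`, and
`E(bc) ∈ B` crosses the tensor sign. -/
theorem sandwich_quasibasis (E : BimoduleHom B B A B) (L : LeftQuasibasis B)
    (Q : RightQuasibasis B) (x y : TensorSquare B) :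
    ∑ j, sandwich E x (mapSecond (Q.γ j) y) • (Q.u j : TensorSquare B) =
      ∑ i, op (sandwich E (mapFirst (L.β i) x) y) • (L.t i : TensorSquare B) := by
  refine BalTensor.induction_on x (by simp) (fun a b => ?_) (fun x x' hx hx' => ?_)
  · refine BalTensor.induction_on y (by simp) (fun c d => ?_) (fun y y' hy hy' => ?_)
    · simp only [mapFirst_tmul, mapSecond_tmul, sandwich_tmul_tmul]
      rw [← Q.eq]
      simp only [mul_assoc (L.β _ a)]
      rw [← L.eq]
      exact op_smul_tmul a (E (b * c)) d
    · simp only [map_add, add_smul, op_add, Finset.sum_add_distrib, hy, hy']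
  · simp only [map_add, sandwich_add, add_smul, op_add, Finset.sum_add_distrib, hx, hx']

theorem IsFrobeniusExtension.coringT_isFrobenius (hD2 : IsDepthTwo B)
    (h : IsFrobeniusExtension B) : (coringT hD2).IsFrobenius := by
  obtain ⟨E, e, hcas, hE⟩ := h
  let eT : T B := ⟨e, fun b => hcas b⟩
  refine ⟨pairingT E, eT, fun r => Subtype.ext (hcas r), fun c => ⟨?_, ?_⟩, fun c c' => ?_⟩
  · apply Subtype.ext
    rw [coe_pairingT, coringT_counit]
    change sandwich E c.1 e = _
    refine BalTensor.induction_on c.1 (by simp) (fun a b => ?_) (fun x y hx hy => ?_)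
    -- The Casimir element sits in the second slot here, so the pairing is regrouped as `a · E(b e¹)
    -- e²` before the Frobenius equation applies.
    · have h1 : ∀ y : TensorSquare B, sandwich E (tmul B a b) y = a * applyFirst E (b • y) := by
        intro y
        refine BalTensor.induction_on y (by simp) (fun c d => ?_) (fun x y hx hy => ?_)
        · exact mul_assoc _ _ _
        · simp only [map_add, smul_add, mul_add, hx, hy]
      rw [h1, (hE b).2, mulMap_tmul]
    · rw [sandwich_add, hx, hy, BimoduleHom.map_add]
  · apply Subtype.ext
    rw [coe_pairingT, coringT_counit]
    change sandwich E e c.1 = _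
    refine BalTensor.induction_on c.1 (by simp) (fun a b => ?_) (fun x y hx hy => ?_)
    · rw [sandwich_tmul, (hE a).1, mulMap_tmul]
    · rw [_root_.map_add, hx, hy, BimoduleHom.map_add]
  · obtain ⟨L⟩ := hD2.1.exists_quasibasis
    obtain ⟨Q⟩ := hD2.2.exists_quasibasis
    -- The comultiplication is independent of the quasibasis: the right formula makes `γ(c ⊗ c'₁)
    -- c'₂` computable, the left formula `c₁ γ(c₂ ⊗ c')`.
    rw [coringT_comul' hD2 Q, coringT_comul hD2 L, map_sum, map_sum]
    apply Subtype.ext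
    rw [AddSubgroup.val_finsetSum, AddSubgroup.val_finsetSum]
    exact sandwich_quasibasis E L Q c.1 c'.1

/-! ### Frobenius corings give Frobenius extensions -/

variable (B) in
/-- The element `1 ⊗ 1` of `T`. -/
def oneT : T B :=
  ⟨tmul B 1 1, fun b => by
    rw [BalTensor.smul_tmul, BalTensor.op_smul_tmul']
    simpa [op_smul_def, Subring.smul_def] using op_smul_tmul (R := B) (1 : A) b (1 : A)⟩

theorem coe_smul_oneT (r : centr B) : ((r • oneT B : T B) : TensorSquare B) = tmul B (r : A) 1 :=
  congrArg (tmul B · 1) (mul_one (r : A))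

theorem coe_op_smul_oneT (r : centr B) :
    ((op r • oneT B : T B) : TensorSquare B) = tmul B 1 (r : A) :=
  congrArg (tmul B 1) (one_mul (r : A))

/-! ### Uses of centrality, the generator property and `A = BR` -/

/-- `b β(r) = β(br) = β(rb) = β(r) b`. It makes the values `βᵢ(1)` and `γⱼ(1)` scalars of `R`, which
can be moved through the pairing. -/
theorem bimoduleHom_apply_mem_centr (β : BimoduleHom B B A A) (r : centr B) :
    β r ∈ centr B := by
  rw [Subring.mem_centralizer_iff]
  intro b hb
  have h1 := β.map_smul ⟨b, hb⟩ (r : A)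
  have h2 := β.map_op_smul ⟨b, hb⟩ (r : A)
  change β (b * r) = b * β r at h1
  change β (r * b) = β r * b at h2
  rw [← h1, ← h2, centr_comm r ⟨b, hb⟩]

/-- Elements `a` with `a ⊗ 1 = 1 ⊗ a` in `A ⊗_B A` lie in `B` when `A_B` is a generator. -/
theorem mem_of_tmul_one_eq {n : ℕ} (f : (Fin n → A) →ₗ[(↥B)ᵐᵒᵖ] B) (hf : Function.Surjective f)
    {a : A} (ha : tmul B a 1 = tmul B 1 a) : a ∈ B := by
  obtain ⟨y, hy⟩ := hf 1
  -- Left multiplication by the coordinates of a preimage `y` of `1` is right `B`-linear, so the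
  -- generator property yields a functional on `A_B` with value `1` at `1`.
  let p : A →ₗ[(↥B)ᵐᵒᵖ] B :=
    { toFun := fun x => f (fun i => y i * x)
      map_add' := fun x x' => by
        rw [← map_add]
        exact congrArg f (funext fun i => mul_add _ _ _)
      map_smul' := fun b x => by
        rw [RingHom.id_apply, ← map_smul]
        exact congrArg f (funext fun i => (mul_assoc _ _ _).symm) }
  have hp : p 1 = 1 := by
    rw [← hy]
    exact congrArg f (funext fun i => mul_one _)
  -- Applying `x ⊗ z ↦ p(x) z` to `a ⊗ 1 = 1 ⊗ a` gives `p(a) = p(1) a = a`.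
  let q : TensorSquare B →+ A := BalTensor.lift
    (AddMonoidHom.mk' (fun x : A => AddMonoidHom.mulLeft (p x : A))
      (fun x x' => by ext z; simp [add_mul]))
    (fun x b z => by
      change (p (op b • x) : A) * z = (p x : A) * (b * z)
      rw [map_smul, ← mul_assoc]
      rfl)
  have h : (p a : A) * 1 = (p 1 : A) * a := congrArg q ha
  rw [hp, mul_one, OneMemClass.coe_one, one_mul] at h
  exact h ▸ (p a).2

/-- Additive maps on a Procesi extension that agree on products `b r` are equal. -/
theorem IsProcesi.hom_ext (hP : IsProcesi B) {P : Type*} [AddCommGroup P] {f g : A →+ P}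
    (h : ∀ (b : B) (r : centr B), f (b * r) = g (b * r)) : f = g := by
  refine AddMonoidHom.eq_of_eqOn_dense hP ?_
  rintro _ ⟨b, hb, r, hr, rfl⟩
  exact h ⟨b, hb⟩ ⟨r, hr⟩

/-- The `B`-bimodule endomorphism `a ↦ ∑ⱼ γⱼ(a) γ(uⱼ ⊗ 1_T)`. -/
def frobeniusEnd (Q : RightQuasibasis B)
    (γ : BimoduleHom (centr B) (centr B) (BalTensor (centr B) (T B) (T B)) (centr B)) :
    BimoduleHom B B A A where
  toAddMonoidHom := ∑ j, (AddMonoidHom.mulRight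
    (γ (tmul (centr B) (Q.u j) (oneT B)) : A)).comp (Q.γ j).toAddMonoidHom
  map_left b a := by
    change (∑ j, _ : A →+ A) (b • a) = b • (∑ j, _ : A →+ A) a
    rw [AddMonoidHom.finsetSum_apply, AddMonoidHom.finsetSum_apply, Finset.smul_sum]
    refine Finset.sum_congr rfl fun j _ => ?_
    change Q.γ j (b • a) * _ = b • (Q.γ j a * _)
    rw [BimoduleHom.map_smul]
    exact mul_assoc _ _ _
  map_right b a := by
    change (∑ j, _ : A →+ A) (op b • a) = op b • (∑ j, _ : A →+ A) a
    rw [AddMonoidHom.finsetSum_apply, AddMonoidHom.finsetSum_apply, Finset.smul_sum]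
    refine Finset.sum_congr rfl fun j _ => ?_
    change Q.γ j (op b • a) * _ = op b • (Q.γ j a * _)
    -- The values of `γ` lie in `R`, so `b` commutes past the right-hand factor.
    rw [BimoduleHom.map_op_smul, op_smul_def, op_smul_def, mul_assoc, centr_comm, mul_assoc]

/-! ### The endomorphism `F` recovered from the coring pairing -/

section FrobeniusEnd

variable (L : LeftQuasibasis B) (Q : RightQuasibasis B)
  (γ : BimoduleHom (centr B) (centr B) (BalTensor (centr B) (T B) (T B)) (centr B))

theorem frobeniusEnd_apply (a : A) :
    frobeniusEnd Q γ a = ∑ j, Q.γ j a * γ (tmul (centr B) (Q.u j) (oneT B)) :=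
  AddMonoidHom.finsetSum_apply _ _ _

/-- `t¹ F(t²) = γ(t ⊗ 1_T)` -/
theorem mulMap_mapSecond_frobeniusEnd (t : T B) :
    mulMap (mapSecond (frobeniusEnd Q γ) t.1) = γ (tmul (centr B) t (oneT B)) := by
  have h1 : ∀ x : TensorSquare B, mulMap (mapSecond (frobeniusEnd Q γ) x) =
      ∑ j, mulMap (mapSecond (Q.γ j) x) * γ (tmul (centr B) (Q.u j) (oneT B)) := by
    intro x
    refine BalTensor.induction_on x (by simp [BimoduleHom.map_zero]) (fun m n => ?_)
      (fun x y hx hy => ?_)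
    · simp only [mapSecond_tmul, mulMap_tmul, frobeniusEnd_apply, Finset.mul_sum, mul_assoc]
    · simp only [map_add, hx, hy, add_mul, Finset.sum_add_distrib]
  rw [h1]
  conv_rhs => rw [Q.expandT t, sum_tmul]
  rw [map_sum, AddSubmonoidClass.coe_finsetSum]
  refine Finset.sum_congr rfl fun j _ => ?_
  exact (congrArg Subtype.val (γ.map_smul (counitT (mapSecondT (Q.γ j) t))
    (tmul (centr B) (Q.u j) (oneT B)))).symm

/-- Apply `t¹ F(t²) = γ(t ⊗ 1_T)` to `t = 1 ⊗ r = 1_T · r` and move `r` across the tensor. The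
result no longer involves the right quasibasis, which allows comparison with the left one. -/
theorem frobeniusEnd_centr (r : centr B) :
    frobeniusEnd Q γ r = γ (tmul (centr B) (oneT B) (r • oneT B)) := by
  rw [← op_smul_tmul, ← mulMap_mapSecond_frobeniusEnd Q, coe_op_smul_oneT, mapSecond_tmul,
    mulMap_tmul, one_mul]

include L in
/-- `F(t¹) t² = γ(1_T ⊗ t)` -/
theorem mulMap_mapFirst_frobeniusEnd (hP : IsProcesi B) (t : T B) :
    mulMap (mapFirst (frobeniusEnd Q γ) t.1) = γ (tmul (centr B) (oneT B) t) := by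
  have h0 : ∀ s : T B, ((γ (tmul (centr B) (oneT B) s) : centr B) : A) =
      ∑ i, (γ (tmul (centr B) (oneT B) (L.t i)) : A) * mulMap (mapFirst (L.β i) s.1) := by
    intro s
    conv_lhs => rw [L.expandT s, tmul_sum]
    rw [map_sum, AddSubmonoidClass.coe_finsetSum]
    refine Finset.sum_congr rfl fun i _ => ?_
    exact congrArg Subtype.val (γ.map_op_smul (counitT (mapFirstT (L.β i) s))
      (tmul (centr B) (oneT B) (L.t i)))
  -- `F` also has an expansion through the left quasibasis. By `A = BR` it suffices to compare on
  -- `br`; there `b` comes out of `F` and of each `βᵢ`, past coefficients in `R`, and the case of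
  -- `r` is `h0` at `r 1_T`.
  have h1 : (frobeniusEnd Q γ).toAddMonoidHom = ∑ i, (AddMonoidHom.mulLeft
      (γ (tmul (centr B) (oneT B) (L.t i)) : A)).comp (L.β i).toAddMonoidHom := by
    refine hP.hom_ext fun b r => ?_
    rw [AddMonoidHom.finsetSum_apply]
    refine ((frobeniusEnd Q γ).map_smul b (r : A)).trans ?_
    rw [frobeniusEnd_centr, h0, Finset.smul_sum]
    refine Finset.sum_congr rfl fun i _ => ?_
    rw [coe_smul_oneT, mapFirst_tmul, mulMap_tmul, mul_one]
    change _ = _ * L.β i (b • (r : A))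
    rw [BimoduleHom.map_smul, Subring.smul_def, Subring.smul_def, smul_eq_mul, smul_eq_mul,
      ← mul_assoc, ← mul_assoc, centr_comm]
  have h2 : ∀ a, frobeniusEnd Q γ a =
      ∑ i, (γ (tmul (centr B) (oneT B) (L.t i)) : A) * L.β i a := fun a =>
    (DFunLike.congr_fun h1 a).trans (AddMonoidHom.finsetSum_apply _ _ _)
  rw [h0]
  refine BalTensor.induction_on t.1 (by simp [BimoduleHom.map_zero]) (fun m n => ?_)
      (fun x y hx hy => ?_)
  · simp only [mapFirst_tmul, mulMap_tmul, h2, Finset.sum_mul, mul_assoc]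
  · simp only [map_add, hx, hy, mul_add, Finset.sum_add_distrib]

include L in
-- For `r ∈ R` the coring identity at `1_T` and `r 1_T` reads `F(r) ⊗ 1 = 1 ⊗ F(r)`, which forces
-- `F(r) ∈ B`. Left `B`-linearity and `A = BR` then give all values.
theorem frobeniusEnd_mem (hD2 : IsDepthTwo B) (hprog : IsRightProgenerator B) (hP : IsProcesi B)
    (hγ : ∀ c c', Coring.applyLeft γ c ((coringT hD2).comul c') =
      Coring.applyRight γ c' ((coringT hD2).comul c)) (a : A) : frobeniusEnd Q γ a ∈ B := by
  have key : ∀ r : centr B, frobeniusEnd Q γ r ∈ B := by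
    intro r
    obtain ⟨-, -, n, f, hf⟩ := hprog
    refine mem_of_tmul_one_eq f hf ?_
    have hγj : ∀ (β : BimoduleHom B B A A), β 1 ∈ centr B :=
      fun β => bimoduleHom_apply_mem_centr β 1
    have h := hγ (oneT B) (r • oneT B)
    rw [coringT_comul' hD2 Q, coringT_comul hD2 L, map_sum, map_sum] at h
    -- Since `r 1_T = r ⊗ 1` and `1_T = 1 ⊗ 1`, the quasibasis maps only meet the entry `1`. Their
    -- values there are in `R` and can be extracted from `γ` by bilinearity.
    have hl : ∀ j, mapSecondT (Q.γ j) (r • oneT B) =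
        op (⟨Q.γ j 1, hγj _⟩ : centr B) • (r • oneT B) := fun j => by
      apply Subtype.ext
      rw [coe_mapSecondT, coe_op_smul_T, coe_smul_oneT, op_smul_tmul', mapSecond_tmul]
      simp
    have hr : ∀ i, mapFirstT (L.β i) (oneT B) = (⟨L.β i 1, hγj _⟩ : centr B) • oneT B := fun i =>
      Subtype.ext (coe_smul_oneT (⟨L.β i 1, hγj _⟩ : centr B)).symm
    set s := γ (tmul (centr B) (oneT B) (r • oneT B)) with hs
    have hl' : ∀ j, Coring.applyLeft γ (oneT B)
        (tmul (centr B) (mapSecondT (Q.γ j) (r • oneT B)) (Q.u j)) =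
        (s * ⟨Q.γ j 1, hγj _⟩) • Q.u j := fun j => by
      rw [hl]
      change γ (op (⟨Q.γ j 1, hγj _⟩ : centr B) • tmul (centr B) (oneT B) (r • oneT B)) • Q.u j = _
      rw [BimoduleHom.map_op_smul]
      rfl
    have hr' : ∀ i, Coring.applyRight γ (r • oneT B)
        (tmul (centr B) (L.t i) (mapFirstT (L.β i) (oneT B))) =
        op (⟨L.β i 1, hγj _⟩ * s : centr B) • L.t i := fun i => by
      rw [hr]
      change op (γ ((⟨L.β i 1, hγj _⟩ : centr B) • tmul (centr B) (oneT B) (r • oneT B))) • L.t i = _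
      rw [BimoduleHom.map_smul]
      rfl
    rw [Finset.sum_congr rfl fun j _ => hl' j, Finset.sum_congr rfl fun i _ => hr' i] at h
    have h' := congrArg Subtype.val h
    rw [AddSubgroup.val_finsetSum, AddSubgroup.val_finsetSum] at h'
    -- The two sides of `h'` are the right expansion of `s ⊗ 1` and the left expansion of `1 ⊗ s`,
    -- with `s = F(r)`.
    rw [frobeniusEnd_centr, ← hs, Q.eq, L.eq]
    exact h'
  -- Passing to the additive quotient `A / B` turns membership into the vanishing of an additive
  -- map, which can be tested on products `br`.
  have h : (QuotientAddGroup.mk' B.toAddSubgroup).comp (frobeniusEnd Q γ).toAddMonoidHom = 0 := by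
    refine hP.hom_ext fun b r => (QuotientAddGroup.eq_zero_iff _).mpr ?_
    have : frobeniusEnd Q γ (b • (r : A)) ∈ B := by
      rw [BimoduleHom.map_smul]
      exact B.mul_mem b.2 (key r)
    exact this
  exact (QuotientAddGroup.eq_zero_iff _).mp (DFunLike.congr_fun h a)

end FrobeniusEnd

/-! ### The Frobenius system of the extension -/

theorem isFrobeniusExtension_of_coringT (hD2 : IsDepthTwo B) (hprog : IsRightProgenerator B)
    (hP : IsProcesi B) (h : (coringT hD2).IsFrobenius) : IsFrobeniusExtension B := by
  obtain ⟨γ, e, hcent, hcounit, hγ⟩ := h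
  obtain ⟨L⟩ := hD2.1.exists_quasibasis
  obtain ⟨Q⟩ := hD2.2.exists_quasibasis
  have hmem := frobeniusEnd_mem L Q γ hD2 hprog hP hγ
  let E : BimoduleHom B B A B :=
    { (frobeniusEnd Q γ).toAddMonoidHom.codRestrict B hmem with
      map_left := fun b a => Subtype.ext ((frobeniusEnd Q γ).map_smul b a)
      map_right := fun b a => Subtype.ext ((frobeniusEnd Q γ).map_op_smul b a) }
  have hsecond : ∀ x, applySecond E x = mulMap (mapSecond (frobeniusEnd Q γ) x) := fun x =>
    BalTensor.induction_on x (by simp [BimoduleHom.map_zero]) (fun _ _ => rfl)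
      (fun x y hx hy => by simp only [map_add, hx, hy])
  have hfirst : ∀ x, applyFirst E x = mulMap (mapFirst (frobeniusEnd Q γ) x) := fun x =>
    BalTensor.induction_on x (by simp [BimoduleHom.map_zero]) (fun _ _ => rfl)
      (fun x y hx hy => by simp only [map_add, hx, hy])
  have hcas : ∀ a : A, a • e.1 = op a • e.1 := by
    let l : A →+ TensorSquare B := AddMonoidHom.mk' (fun a => a • e.1) (fun a a' => add_smul _ _ _)
    let r : A →+ TensorSquare B := AddMonoidHom.mk' (fun a => op a • e.1)
      (fun a a' => by rw [op_add, add_smul])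
    have hlr : l = r := hP.hom_ext fun b s => by
      change ((b : A) * s) • e.1 = op ((b : A) * s) • e.1
      have hs : (s : A) • e.1 = op (s : A) • e.1 := congrArg Subtype.val (hcent s)
      rw [mul_smul, hs, smul_comm, e.2 b, ← mul_smul, ← op_mul]
    exact DFunLike.congr_fun hlr
  refine ⟨E, e.1, hcas, fun a => ⟨?_, ?_⟩⟩
  · let l : A →+ A := AddMonoidHom.mk' (fun a => applySecond E (op a • e.1))
      (fun a a' => by rw [op_add, add_smul, map_add])
    have hl : l = AddMonoidHom.id A := hP.hom_ext fun b r => by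
      change applySecond E (op ((b : A) * r) • e.1) = (b : A) * r
      -- Writing `br = rb` lets `b` leave `E` on the right. What remains is `e¹ F(e² r) = γ(e r ⊗
      -- 1_T) = γ(e ⊗ r 1_T) = ε(r 1_T) = r`.
      rw [centr_comm, op_mul, mul_smul, applySecond_op_smul, hsecond]
      congr 1
      have h1 := mulMap_mapSecond_frobeniusEnd Q γ (op r • e)
      rw [op_smul_tmul, (hcounit _).2, coringT_counit, coe_smul_oneT, mulMap_tmul, mul_one] at h1
      exact h1
    exact DFunLike.congr_fun hl a
  -- The Casimir property moves `a` out to the right: `E(a e¹) e² = F(e¹) e² a = γ(1_T ⊗ e) a =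
  -- ε(1_T) a = a`.
  · rw [hcas, hfirst, mapFirst_op_smul, BimoduleHom.map_op_smul,
      mulMap_mapFirst_frobeniusEnd L Q γ hP, (hcounit _).1, coringT_counit]
    simp [oneT]

end

end DepthTwo

theorem mainTheorem4 {A : Type*} [Ring A] (B : Subring A)
    (hD2 : DepthTwo.IsDepthTwo B) (hprog : DepthTwo.IsRightProgenerator B)
    (hProcesi : DepthTwo.IsProcesi B) :
    DepthTwo.IsFrobeniusExtension B ↔ (DepthTwo.coringT hD2).IsFrobenius :=
  ⟨fun h => h.coringT_isFrobenius hD2,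
    fun h => DepthTwo.isFrobeniusExtension_of_coringT hD2 hprog hProcesi h⟩
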